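/- Let $1\le k\le n$, let $A,B$ be complex $n\times n$ matrices, and let $s_1(X)\ge s_2(X)\ge\cdots\ge 0$ denote the singular values of a complex matrix $X$, repeated according to multiplicity. Let $\|X\|_{(k)}=s_1(X)+\cdots+s_k(X)$ be the Ky Fan $k$-norm on the $n\times n$ matrices; $A$ is said to be (Birkhoff–James) orthogonal to $B$ in $\|\cdot\|_{(k)}$ if $\|A+\lambda B\|_{(k)}\ge\|A\|_{(k)}$ for all $\lambda\in\mathbb C$. Let $A=USV^*$ be a singular value decomposition of $A$, that is, $U,V$ are unitary and $S=\operatorname{diag}(s_1(A),\dots,s_n(A))$. Let the multiplicity of $s_k(A)$ among $s_1(A),\dots,s_n(A)$ be $r+q$, where $r\ge 0$ and $q\ge 1$ are such that $$s_{k-q+1}(A)=\cdots=s_{k+r}(A)$$ (so $q\le k$ and $k+r\le n$). Let $$B=U\begin{bmatrix}B_{11}&B_{12}&B_{13}\\B_{21}&B_{22}&B_{23}\\B_{31}&B_{32}&B_{33}\end{bmatrix}V^*,$$ where $B_{11}$, $B_{22}$, $B_{33}$ are square of sizes $k-q$, $r+q$, $n-k-r$, respectively. (a) Let $s_k(A)>0$.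 Then $A$ is orthogonal to $B$ in $\|\cdot\|_{(k)}$ if and only if there exists a positive semidefinite $(r+q)\times(r+q)$ complex matrix $T$, with eigenvalues $\lambda_1(T)\ge\cdots\ge\lambda_{r+q}(T)$, such that $\lambda_1(T)\le 1$, $\sum_{j=1}^{r+q}\lambda_j(T)=q$ and $$\operatorname{tr}B_{11}+\operatorname{tr}(T^*B_{22})=0.$$ (b) Let $s_k(A)=0$. Then $A$ is orthogonal to $B$ in $\|\cdot\|_{(k)}$ if and only if there exists an $(n-k+q)\times(r+q)$ complex matrix $T$ such that $s_1(T)\le 1$, $\sum_{j=1}^{r+q}s_j(T)\le q$ and $$\operatorname{tr}B_{11}+\operatorname{tr}\left(T^*\begin{bmatrix}B_{22}\\B_{32}\end{bmatrix}\right)=0.$$ -/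

import Mathlib

open scoped ComplexOrder

namespace KyFanBJ

/-- The `i`-th singular value of a complex (possibly rectangular) matrix, in decreasing order,
repeated according to multiplicity and counted from `0`: `singVal A 0` is `s_1(A)`, and
`singVal A (k - 1)` is `s_k(A)` for `k ≥ 1`. -/
noncomputable def singVal {m n : Type*} [Fintype m] [Fintype n] [DecidableEq n]
    (A : Matrix m n ℂ) (i : ℕ) : ℝ :=
  (Matrix.toEuclideanLin A).singularValues i

/-- The Ky Fan `k`-norm `s_1(A) + ⋯ + s_k(A)`. -/
noncomputable def kyFanNorm {n : ℕ} (k : ℕ) (A : Matrix (Fin n) (Fin n) ℂ) : ℝ :=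
  ∑ i ∈ Finset.range k, singVal A i

/-- `A` is Birkhoff-James orthogonal to `B` in the norm `N`:
`N (A + c B) ≥ N A` for every complex scalar `c`. -/
def IsBJOrthogonal {n : ℕ} (N : Matrix (Fin n) (Fin n) ℂ → ℝ)
    (A B : Matrix (Fin n) (Fin n) ℂ) : Prop :=
  ∀ c : ℂ, N (A + c • B) ≥ N A

/-- `A = U S V*` is a singular value decomposition: `U`, `V` are unitary and `S` is the diagonal
matrix with diagonal `s_1(A) ≥ s_2(A) ≥ ⋯ ≥ s_n(A)`. -/
def IsSVD {n : ℕ} (A U S V : Matrix (Fin n) (Fin n) ℂ) : Prop :=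
  U ∈ Matrix.unitaryGroup (Fin n) ℂ ∧ V ∈ Matrix.unitaryGroup (Fin n) ℂ ∧
    S = Matrix.diagonal (fun i : Fin n => ((singVal A (i : ℕ) : ℝ) : ℂ)) ∧
    A = U * S * V.conjTranspose

/-- The multiplicity of the real number `t` among the singular values `s_1(A), …, s_n(A)`. -/
noncomputable def singMult {n : ℕ} (A : Matrix (Fin n) (Fin n) ℂ) (t : ℝ) : ℕ :=
  Nat.card {i : Fin n // singVal A (i : ℕ) = t}

/-- The order-preserving splitting of `n` indices into consecutive groups of sizes
`k - q`, `r + q` and `n - k - r`. -/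
def blockEquiv (n k q r : ℕ) (hqk : q ≤ k) (hkr : k + r ≤ n) :
    Fin (k - q) ⊕ (Fin (r + q) ⊕ Fin (n - k - r)) ≃ Fin n :=
  (Equiv.sumCongr (Equiv.refl _) finSumFinEquiv).trans
    (finSumFinEquiv.trans (finCongr (by omega)))

/-- The `n × n` matrix with the nine given blocks, in the usual `3 × 3` layout. -/
def blockMatrix (n k q r : ℕ) (hqk : q ≤ k) (hkr : k + r ≤ n)
    (B11 : Matrix (Fin (k - q)) (Fin (k - q)) ℂ)
    (B12 : Matrix (Fin (k - q)) (Fin (r + q)) ℂ)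
    (B13 : Matrix (Fin (k - q)) (Fin (n - k - r)) ℂ)
    (B21 : Matrix (Fin (r + q)) (Fin (k - q)) ℂ)
    (B22 : Matrix (Fin (r + q)) (Fin (r + q)) ℂ)
    (B23 : Matrix (Fin (r + q)) (Fin (n - k - r)) ℂ)
    (B31 : Matrix (Fin (n - k - r)) (Fin (k - q)) ℂ)
    (B32 : Matrix (Fin (n - k - r)) (Fin (r + q)) ℂ)
    (B33 : Matrix (Fin (n - k - r)) (Fin (n - k - r)) ℂ) :
    Matrix (Fin n) (Fin n) ℂ :=
  Matrix.reindex (blockEquiv n k q r hqk hkr) (blockEquiv n k q r hqk hkr)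
    (Matrix.fromBlocks B11 (Matrix.fromCols B12 B13) (Matrix.fromRows B21 B31)
      (Matrix.fromBlocks B22 B23 B32 B33))

end KyFanBJ

/-! The Ky Fan norm is a support function: `‖X‖_(k)` is the maximum of `Re tr(W* X)` over the
compact convex set `dualBall` of matrices with `s_1(W) ≤ 1` and `∑ s_i(W) ≤ k`. Describing this set
by its diagonals in all pairs of orthonormal bases makes it visibly convex, closed and unitarily
invariant; `mul_diagonal_mul_mem_dualBall` and `exists_svd_of_mem_dualBall` recover the singular
value description.

Let the face of `A` be the set of `W` attaining the maximum at `A`. Then `A` is orthogonal to `B`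
iff `tr(W* B) = 0` for some `W` in the face. Such a `W` gives `‖A + cB‖ ≥ Re tr(W*(A + cB)) = ‖A‖`.
Conversely, the numbers `tr(W* B)`, for `W` in the face, form a compact convex subset of `ℂ`; if it
missed `0`, a separating functional would provide a direction `c` along which the norm drops
(`exists_mem_dualBall_trace_eq_zero`).

It remains to find the face at the diagonal matrix `S`, with `t = s_k(A)`. Equality in the
rearrangement bound forces diagonal entries `1` where `s_i > t` and `0` where `s_i < t`, and trace
`k` if `t > 0` (`diag_of_sum_mul_re_eq`). Entries of modulus one clear their rows and columns. If `t
> 0`, maximal trace makes `W` positive semidefinite, so zero diagonal entries clear theirs too, and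
`W = I ⊕ T ⊕ 0` with `tr T = q`. If `t = 0`, the third block is empty and the trace constraint
disappears, leaving `T` any element of the dual ball of parameter `q`. -/

namespace KyFanBJ

section
open Matrix

/-! ### Singular value decomposition -/

/-- Singular value decomposition of a linear map between spaces of equal dimension. -/
theorem exists_orthonormalBasis_singularValues {E F : Type*}
    [NormedAddCommGroup E] [InnerProductSpace ℂ E] [FiniteDimensional ℂ E]
    [NormedAddCommGroup F] [InnerProductSpace ℂ F] [FiniteDimensional ℂ F] {n : ℕ}
    (hE : Module.finrank ℂ E = n) (hF : Module.finrank ℂ F = n) (T : E →ₗ[ℂ] F) :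
    ∃ (v : OrthonormalBasis (Fin n) ℂ E) (u : OrthonormalBasis (Fin n) ℂ F),
      ∀ i, T (v i) = ((T.singularValues i : ℝ) : ℂ) • u i := by
  have hT := T.isSymmetric_adjoint_comp_self
  let v := hT.eigenvectorBasis hE
  have hin : ∀ i j, inner ℂ (T (v i)) (T (v j)) =
      (if i = j then (((T.singularValues j : ℝ) ^ 2 : ℝ) : ℂ) else 0) := by
    intro i j
    have h1 : inner ℂ (T (v i)) (T (v j)) = inner ℂ (v i) ((T.adjoint ∘ₗ T) (v j)) := by
      simp [LinearMap.adjoint_inner_right]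
    rw [h1, hT.apply_eigenvectorBasis hE j, inner_smul_right, v.inner_eq_ite,
      T.sq_singularValues_fin hE]
    split_ifs with h <;> simp
  have hnorm : ∀ i, ‖T (v i)‖ = T.singularValues i := by
    intro i
    have h := hin i i
    rw [inner_self_eq_norm_sq_to_K, if_pos rfl] at h
    have h2 : ‖T (v i)‖ ^ 2 = (T.singularValues i) ^ 2 := by
      apply Complex.ofReal_injective
      simpa using h
    exact (pow_left_inj₀ (norm_nonneg _) (T.singularValues_nonneg i) two_ne_zero).1 h2
  have horth : Pairwise fun i j => inner ℂ (T (v i)) (T (v j)) = 0 := fun i j hij => by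
    change inner ℂ (T (v i)) (T (v j)) = 0
    rw [hin, if_neg hij]
  have hc : Module.finrank ℂ F = Fintype.card (Fin n) := by simpa using hF
  -- The images `T (v i)` are already orthogonal, so Gram-Schmidt only normalises the nonzero ones;
  -- whatever it puts in the other places is multiplied by a zero singular value.
  refine ⟨v, InnerProductSpace.gramSchmidtOrthonormalBasis hc (fun i => T (v i)), fun i => ?_⟩
  by_cases h0 : T (v i) = 0
  · have : T.singularValues i = 0 := by rw [← hnorm, h0, norm_zero]
    simp [h0, this]
  · rw [InnerProductSpace.gramSchmidtOrthonormalBasis_apply_of_orthogonal hc horth h0, ← hnorm,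
      smul_smul]
    have : ((‖T (v i)‖ : ℝ) : ℂ) ≠ 0 := by simpa using h0
    simp [this]

/-- The matrix whose columns are an orthonormal basis is unitary. -/
theorem of_orthonormalBasis_mem_unitaryGroup {n : ℕ}
    (b : OrthonormalBasis (Fin n) ℂ (EuclideanSpace ℂ (Fin n))) :
    (Matrix.of fun i j => b j i) ∈ unitaryGroup (Fin n) ℂ := by
  rw [mem_unitaryGroup_iff']
  ext i j
  have h := b.inner_eq_ite i j
  rw [PiLp.inner_apply] at h
  simp only [star_eq_conjTranspose, mul_apply, conjTranspose_apply, of_apply, one_apply, ← h]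
  exact Finset.sum_congr rfl fun x _ => by simp [mul_comm]

/-- Every square complex matrix has a singular value decomposition. -/
theorem exists_svd {n : ℕ} (X : Matrix (Fin n) (Fin n) ℂ) :
    ∃ P ∈ unitaryGroup (Fin n) ℂ, ∃ Q ∈ unitaryGroup (Fin n) ℂ,
      X = P * diagonal (fun i : Fin n => ((singVal X i : ℝ) : ℂ)) * Qᴴ := by
  obtain ⟨v, u, h⟩ := exists_orthonormalBasis_singularValues (n := n) (by simp) (by simp)
    (toEuclideanLin X)
  refine ⟨_, of_orthonormalBasis_mem_unitaryGroup u, _, of_orthonormalBasis_mem_unitaryGroup v, ?_⟩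
  have hv := mem_unitaryGroup_iff.1 (of_orthonormalBasis_mem_unitaryGroup v)
  have key : X * (Matrix.of fun i j => v j i) =
      (Matrix.of fun i j => u j i) * diagonal (fun i : Fin n => ((singVal X i : ℝ) : ℂ)) := by
    ext i j
    have h' := congrArg (fun x : EuclideanSpace ℂ (Fin n) => x i) (h j)
    simp only [ofLp_toLpLin, toLin'_apply] at h'
    rw [mul_diagonal, mul_apply]
    simpa [mulVec, dotProduct, singVal, mul_comm] using h'
  rw [← key, mul_assoc, ← star_eq_conjTranspose, hv, mul_one]

theorem singVal_nonneg {m n : Type*} [Fintype m] [Fintype n] [DecidableEq n]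
    (X : Matrix m n ℂ) (i : ℕ) : 0 ≤ singVal X i :=
  LinearMap.singularValues_nonneg _ _

theorem singVal_antitone {m n : Type*} [Fintype m] [Fintype n] [DecidableEq n]
    (X : Matrix m n ℂ) : Antitone (singVal X) :=
  LinearMap.singularValues_antitone _

/-- Singular values of `X` depend only on `Xᴴ X`. -/
theorem singVal_congr {l m n : Type*} [Fintype l] [Fintype m] [Fintype n]
    [DecidableEq n] {X : Matrix l n ℂ} {Y : Matrix m n ℂ}
    (h : Xᴴ * X = Yᴴ * Y) (i : ℕ) : singVal X i = singVal Y i := by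
  classical
  have h' : (toEuclideanLin X).adjoint ∘ₗ toEuclideanLin X =
      (toEuclideanLin Y).adjoint ∘ₗ toEuclideanLin Y := by
    rw [← toEuclideanLin_conjTranspose_eq_adjoint, ← toEuclideanLin_conjTranspose_eq_adjoint]
    ext x : 1
    simp only [LinearMap.comp_apply, toLpLin_apply, mulVec_mulVec, h]
  unfold singVal
  by_cases hi : i < Module.finrank ℂ (EuclideanSpace ℂ n)
  · rw [LinearMap.singularValues_of_lt _ rfl hi, LinearMap.singularValues_of_lt _ rfl hi]
    congr 2
  · rw [LinearMap.singularValues_of_finrank_le _ (not_lt.1 hi),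
      LinearMap.singularValues_of_finrank_le _ (not_lt.1 hi)]

/-! ### The dual ball and its unitary invariance -/

variable {ι κ : Type*} [Fintype ι] [DecidableEq ι] [Fintype κ] [DecidableEq κ]

/-- The matrices `W` such that every diagonal of `W` with respect to a pair of orthonormal bases has
entries of modulus at most `1` with sum of moduli at most `k`.  This is the unit ball
for the dual of the Ky Fan `k`-norm. -/
def dualBall (ι : Type*) [Fintype ι] [DecidableEq ι] (k : ℝ) : Set (Matrix ι ι ℂ) :=
  {W | ∀ P ∈ unitaryGroup ι ℂ, ∀ Q ∈ unitaryGroup ι ℂ,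
    (∀ i, ‖(Pᴴ * W * Q) i i‖ ≤ 1) ∧ ∑ i, ‖(Pᴴ * W * Q) i i‖ ≤ k}

theorem conjTranspose_mem_unitaryGroup {P : Matrix ι ι ℂ} (hP : P ∈ unitaryGroup ι ℂ) :
    Pᴴ ∈ unitaryGroup ι ℂ :=
  Unitary.star_mem hP

theorem conjTranspose_mul_self_of_unitary {P : Matrix ι ι ℂ} (hP : P ∈ unitaryGroup ι ℂ) :
    Pᴴ * P = 1 :=
  mem_unitaryGroup_iff'.1 hP

theorem mul_conjTranspose_self_of_unitary {P : Matrix ι ι ℂ} (hP : P ∈ unitaryGroup ι ℂ) :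
    P * Pᴴ = 1 :=
  mem_unitaryGroup_iff.1 hP

theorem conjTranspose_mul_mul_of_unitary {P Q : Matrix ι ι ℂ} (hP : P ∈ unitaryGroup ι ℂ)
    (hQ : Q ∈ unitaryGroup ι ℂ) (D : Matrix ι ι ℂ) : Pᴴ * (P * D * Qᴴ) * Q = D := by
  rw [mul_assoc P, ← mul_assoc Pᴴ, conjTranspose_mul_self_of_unitary hP, one_mul, mul_assoc,
    conjTranspose_mul_self_of_unitary hQ, mul_one]

theorem mul_conjTranspose_apply_self {ι : Type*} [Fintype ι] (M : Matrix ι ι ℂ) (i : ι) :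
    (M * Mᴴ) i i = ((∑ j, ‖M i j‖ ^ 2 : ℝ) : ℂ) := by
  rw [mul_apply]
  push_cast
  exact Finset.sum_congr rfl fun j _ => by
    rw [conjTranspose_apply, Complex.star_def, Complex.mul_conj, Complex.normSq_eq_norm_sq]
    push_cast
    rfl

theorem sum_row_norm_sq {R : Matrix ι ι ℂ} (hR : R ∈ unitaryGroup ι ℂ) (i : ι) :
    ∑ j, ‖R i j‖ ^ 2 = 1 := by
  have h := mul_conjTranspose_apply_self R i
  rw [mul_conjTranspose_self_of_unitary hR, one_apply_eq] at h
  exact_mod_cast h.symm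

theorem sum_col_norm_sq {R : Matrix ι ι ℂ} (hR : R ∈ unitaryGroup ι ℂ) (j : ι) :
    ∑ i, ‖R i j‖ ^ 2 = 1 := by
  simpa using sum_row_norm_sq (conjTranspose_mem_unitaryGroup hR) j

/-- AM-GM on each product `‖R i j‖ ‖M j i‖`. For unitary `R` and `M` the resulting weights are
doubly stochastic. -/
theorem norm_mul_diagonal_mul_apply_le (R M : Matrix ι ι ℂ) {τ : ι → ℝ} (h0 : ∀ i, 0 ≤ τ i)
    (i : ι) : ‖(R * diagonal (fun j => (τ j : ℂ)) * M) i i‖ ≤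
      ∑ j, τ j * ((‖R i j‖ ^ 2 + ‖M j i‖ ^ 2) / 2) := by
  rw [mul_apply]
  refine (norm_sum_le _ _).trans (Finset.sum_le_sum fun j _ => ?_)
  rw [mul_diagonal, norm_mul, norm_mul, Complex.norm_real, Real.norm_of_nonneg (h0 j)]
  nlinarith [mul_nonneg (h0 j) (sq_nonneg (‖R i j‖ - ‖M j i‖))]

/-- In any pair of bases the moduli of the diagonal are bounded by doubly stochastic averages of
`τ`, which preserve both the bound `1` and the total. -/
theorem mul_diagonal_mul_mem_dualBall {P Q : Matrix ι ι ℂ} (hP : P ∈ unitaryGroup ι ℂ)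
    (hQ : Q ∈ unitaryGroup ι ℂ) {τ : ι → ℝ} {k : ℝ} (h0 : ∀ i, 0 ≤ τ i) (h1 : ∀ i, τ i ≤ 1)
    (hk : ∑ i, τ i ≤ k) : P * diagonal (fun i => (τ i : ℂ)) * Qᴴ ∈ dualBall ι k := by
  intro P' hP' Q' hQ'
  have hR : P'ᴴ * P ∈ unitaryGroup ι ℂ := mul_mem (conjTranspose_mem_unitaryGroup hP') hP
  have hM : Qᴴ * Q' ∈ unitaryGroup ι ℂ := mul_mem (conjTranspose_mem_unitaryGroup hQ) hQ'
  have e : P'ᴴ * (P * diagonal (fun i => (τ i : ℂ)) * Qᴴ) * Q' =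
      (P'ᴴ * P) * diagonal (fun i => (τ i : ℂ)) * (Qᴴ * Q') := by
    simp only [mul_assoc]
  rw [e]
  constructor
  · intro i
    refine (norm_mul_diagonal_mul_apply_le _ _ h0 i).trans ?_
    calc _ ≤ ∑ j, ((‖(P'ᴴ * P) i j‖ ^ 2 + ‖(Qᴴ * Q') j i‖ ^ 2) / 2) :=
          Finset.sum_le_sum fun j _ => mul_le_of_le_one_left (by positivity) (h1 j)
      _ = 1 := by
          rw [← Finset.sum_div, Finset.sum_add_distrib, sum_row_norm_sq hR, sum_col_norm_sq hM]
          norm_num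
  · refine (Finset.sum_le_sum fun i _ => norm_mul_diagonal_mul_apply_le _ _ h0 i).trans ?_
    rw [Finset.sum_comm]
    refine le_trans (le_of_eq (Finset.sum_congr rfl fun j _ => ?_)) hk
    rw [← Finset.mul_sum, ← Finset.sum_div, Finset.sum_add_distrib, sum_col_norm_sq hR,
      sum_row_norm_sq hM]
    ring

theorem unitary_mul_mul_mem_dualBall {U V W : Matrix ι ι ℂ} (hU : U ∈ unitaryGroup ι ℂ)
    (hV : V ∈ unitaryGroup ι ℂ) {k : ℝ} (hW : W ∈ dualBall ι k) :
    U * W * Vᴴ ∈ dualBall ι k := by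
  intro P hP Q hQ
  have := hW (Uᴴ * P) (mul_mem (conjTranspose_mem_unitaryGroup hU) hP) (Vᴴ * Q)
    (mul_mem (conjTranspose_mem_unitaryGroup hV) hQ)
  simpa only [conjTranspose_mul, conjTranspose_conjTranspose, mul_assoc] using this

theorem submatrix_mem_unitaryGroup {P : Matrix ι ι ℂ} (hP : P ∈ unitaryGroup ι ℂ) (e : κ ≃ ι) :
    P.submatrix e e ∈ unitaryGroup κ ℂ := by
  rw [mem_unitaryGroup_iff, star_eq_conjTranspose, conjTranspose_submatrix,
    submatrix_mul_equiv, mul_conjTranspose_self_of_unitary hP, submatrix_one_equiv]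

theorem submatrix_mem_dualBall {W : Matrix ι ι ℂ} {k : ℝ} (hW : W ∈ dualBall ι k) (e : κ ≃ ι) :
    W.submatrix e e ∈ dualBall κ k := by
  intro P hP Q hQ
  have h := hW _ (submatrix_mem_unitaryGroup hP e.symm) _ (submatrix_mem_unitaryGroup hQ e.symm)
  have e1 : (P.submatrix e.symm e.symm)ᴴ * W * Q.submatrix e.symm e.symm =
      (Pᴴ * W.submatrix e e * Q).submatrix e.symm e.symm := by
    rw [conjTranspose_submatrix, ← submatrix_mul_equiv _ _ _ e.symm _,
      ← submatrix_mul_equiv _ _ _ e.symm _]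
    simp
  rw [e1] at h
  refine ⟨fun i => by simpa using h.1 (e i), ?_⟩
  rw [← e.sum_comp] at h
  simpa using h.2

/-- The weighted trace pairing in terms of a factorisation `X = P diag(σ) Qᴴ`. -/
theorem trace_conjTranspose_mul_diagonal (W P Q : Matrix ι ι ℂ) (σ : ι → ℝ) :
    (Wᴴ * (P * diagonal (fun i => (σ i : ℂ)) * Qᴴ)).trace.re =
      ∑ i, σ i * ((Pᴴ * W * Q) i i).re := by
  have : (Wᴴ * (P * diagonal (fun i => (σ i : ℂ)) * Qᴴ)).trace =
      ((Pᴴ * W * Q)ᴴ * diagonal (fun i => (σ i : ℂ))).trace := by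
    rw [← mul_assoc, trace_mul_comm]
    simp only [conjTranspose_mul, conjTranspose_conjTranspose, mul_assoc]
  rw [this, trace, Complex.re_sum]
  refine Finset.sum_congr rfl fun i _ => ?_
  rw [diag_apply, mul_diagonal, conjTranspose_apply, Complex.re_mul_ofReal, Complex.star_def,
    Complex.conj_re, mul_comm]

/-! ### Duality with the Ky Fan norm -/

/-- A weighted sum with decreasing weights and coefficients in `[0, 1]` of total at most `k` is at
most the sum of the first `k` weights. -/
theorem sum_mul_le_sum_range {n k : ℕ} (hkn : k ≤ n) {s : ℕ → ℝ} (hs : Antitone s)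
    (hs0 : ∀ i, 0 ≤ s i) {y : Fin n → ℝ} (h0 : ∀ i, 0 ≤ y i) (h1 : ∀ i, y i ≤ 1)
    (hk : ∑ i, y i ≤ k) : ∑ i : Fin n, s i * y i ≤ ∑ i ∈ Finset.range k, s i := by
  -- After subtracting the threshold `s k`, the weights are nonnegative before index `k` and
  -- nonpositive from it on, so terms can be bounded one by one. The subtracted part is restored at
  -- the end by `∑ y ≤ k` and `0 ≤ s k`.
  have h : ∀ i : Fin n, (s i - s k) * y i ≤ if (i : ℕ) < k then s i - s k else 0 := by
    intro i
    split_ifs with hi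
    · exact mul_le_of_le_one_right (sub_nonneg.2 (hs hi.le)) (h1 i)
    · exact mul_nonpos_of_nonpos_of_nonneg (sub_nonpos.2 (hs (not_lt.1 hi))) (h0 i)
  have h2 : ∑ i : Fin n, (if (i : ℕ) < k then s i - s k else 0) =
      ∑ i ∈ Finset.range k, s i - k * s k := by
    rw [Fin.sum_univ_eq_sum_range (fun i => if i < k then s i - s k else 0), ← Finset.sum_filter]
    have : (Finset.range n).filter (· < k) = Finset.range k := by
      ext i
      simp only [Finset.mem_filter, Finset.mem_range]
      omega
    rw [this, Finset.sum_sub_distrib]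
    simp
  have h3 := Finset.sum_le_sum fun i (_ : i ∈ Finset.univ) => h i
  rw [h2] at h3
  simp only [sub_mul, Finset.sum_sub_distrib, ← Finset.mul_sum] at h3
  nlinarith [mul_le_mul_of_nonneg_left hk (hs0 k)]

/-- In the singular bases of `X` the pairing only sees the diagonal of `W`, weighted by the singular
values. -/
theorem re_trace_le_kyFanNorm {n k : ℕ} (hkn : k ≤ n) {W : Matrix (Fin n) (Fin n) ℂ}
    (hW : W ∈ dualBall (Fin n) k) (X : Matrix (Fin n) (Fin n) ℂ) :
    (Wᴴ * X).trace.re ≤ kyFanNorm k X := by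
  obtain ⟨P, hP, Q, hQ, hX⟩ := exists_svd X
  obtain ⟨h1, h2⟩ := hW P hP Q hQ
  conv_lhs => rw [hX]
  rw [trace_conjTranspose_mul_diagonal]
  refine le_trans (Finset.sum_le_sum fun i _ => ?_)
    (sum_mul_le_sum_range hkn (singVal_antitone X) (singVal_nonneg X)
      (fun i => norm_nonneg _) h1 h2)
  exact mul_le_mul_of_nonneg_left (Complex.re_le_norm _) (singVal_nonneg X i)

theorem exists_re_trace_eq_kyFanNorm {n k : ℕ} (hkn : k ≤ n) (X : Matrix (Fin n) (Fin n) ℂ) :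
    ∃ W ∈ dualBall (Fin n) k, (Wᴴ * X).trace.re = kyFanNorm k X := by
  obtain ⟨P, hP, Q, hQ, hX⟩ := exists_svd X
  have hf : (Finset.range n).filter (· < k) = Finset.range k := by
    ext i
    simp only [Finset.mem_filter, Finset.mem_range]
    omega
  -- The maximiser is the partial isometry matching the first `k` pairs of singular vectors of `X`.
  refine ⟨P * diagonal (fun i : Fin n => ((if (i : ℕ) < k then 1 else 0 : ℝ) : ℂ)) * Qᴴ,
    mul_diagonal_mul_mem_dualBall hP hQ (fun i => by split_ifs <;> norm_num)
      (fun i => by split_ifs <;> norm_num) ?_, ?_⟩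
  · rw [Fin.sum_univ_eq_sum_range (fun i => if i < k then (1 : ℝ) else 0), ← Finset.sum_filter, hf]
    simp
  · conv_lhs => rw [hX]
    rw [trace_conjTranspose_mul_diagonal]
    have e : Pᴴ * (P * diagonal (fun i : Fin n => ((if (i : ℕ) < k then 1 else 0 : ℝ) : ℂ)) * Qᴴ)
        * Q = diagonal (fun i : Fin n => ((if (i : ℕ) < k then 1 else 0 : ℝ) : ℂ)) :=
      conjTranspose_mul_mul_of_unitary hP hQ _
    rw [e]
    simp only [diagonal_apply_eq, Complex.ofReal_re, mul_ite, mul_one, mul_zero]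
    rw [Fin.sum_univ_eq_sum_range (fun i => if i < k then singVal X i else 0),
      ← Finset.sum_filter, hf, kyFanNorm]

/-! ### Entries of elements of the dual ball -/

/-- Coordinates in the factorisation `W = P diag(σ) Qᴴ` of an element of the dual ball. -/
theorem exists_svd_of_mem_dualBall {k : ℝ} {W : Matrix ι ι ℂ} (hW : W ∈ dualBall ι k) :
    ∃ P ∈ unitaryGroup ι ℂ, ∃ Q ∈ unitaryGroup ι ℂ, ∃ σ : ι → ℝ,
      W = P * diagonal (fun i => (σ i : ℂ)) * Qᴴ ∧ (∀ i, 0 ≤ σ i) ∧ (∀ i, σ i ≤ 1) ∧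
        ∑ i, σ i ≤ k := by
  let e := Fintype.equivFin ι
  obtain ⟨P, hP, Q, hQ, h⟩ := exists_svd (W.submatrix e.symm e.symm)
  have hP' := submatrix_mem_unitaryGroup hP e
  have hQ' := submatrix_mem_unitaryGroup hQ e
  let σ : ι → ℝ := fun i => singVal (W.submatrix e.symm e.symm) (e i)
  have hσ : ∀ i, 0 ≤ σ i := fun i => singVal_nonneg _ _
  have hWe : W = P.submatrix e e * diagonal (fun i => (σ i : ℂ)) * (Q.submatrix e e)ᴴ := by
    have := congrArg (fun M => M.submatrix e e) h
    simp only [submatrix_submatrix, Equiv.symm_comp_self, submatrix_id_id] at this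
    rw [this, ← submatrix_mul_equiv _ _ _ e _, ← submatrix_mul_equiv _ _ _ e _,
      submatrix_diagonal_equiv]
    rfl
  refine ⟨_, hP', _, hQ', σ, hWe, hσ, ?_⟩
  -- Testing membership on the singular bases of `W` itself turns the diagonal bounds into bounds on
  -- `σ`.
  have h2 := hW _ hP' _ hQ'
  have e2 : (P.submatrix e e)ᴴ * W * Q.submatrix e e = diagonal (fun i => (σ i : ℂ)) := by
    rw [hWe]
    exact conjTranspose_mul_mul_of_unitary hP' hQ' _
  rw [e2] at h2
  simpa [abs_of_nonneg (hσ _)] using h2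

theorem conjTranspose_mem_dualBall {k : ℝ} {W : Matrix ι ι ℂ} (hW : W ∈ dualBall ι k) :
    Wᴴ ∈ dualBall ι k := by
  obtain ⟨P, hP, Q, hQ, σ, hWσ, h0, h1, hk⟩ := exists_svd_of_mem_dualBall hW
  have : Wᴴ = Q * diagonal (fun i => (σ i : ℂ)) * Pᴴ := by
    rw [hWσ]
    simp only [conjTranspose_mul, conjTranspose_conjTranspose, diagonal_conjTranspose, mul_assoc]
    congr 3
    ext i
    simp
  rw [this]
  exact mul_diagonal_mul_mem_dualBall hQ hP h0 h1 hk

/-- The right factor `Qᴴ` preserves row lengths, and `σ ≤ 1` only shrinks the unit rows of `P`. -/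
theorem sum_row_norm_sq_le_one {k : ℝ} {W : Matrix ι ι ℂ} (hW : W ∈ dualBall ι k) (i : ι) :
    ∑ j, ‖W i j‖ ^ 2 ≤ 1 := by
  obtain ⟨P, hP, Q, hQ, σ, hWσ, h0, h1, -⟩ := exists_svd_of_mem_dualBall hW
  have e : W * Wᴴ = (P * diagonal (fun i => (σ i : ℂ))) * (P * diagonal (fun i => (σ i : ℂ)))ᴴ := by
    rw [hWσ, conjTranspose_mul _ Qᴴ, conjTranspose_conjTranspose, mul_assoc _ Qᴴ, ← mul_assoc Qᴴ,
      conjTranspose_mul_self_of_unitary hQ, one_mul]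
  have h : ∑ j, ‖W i j‖ ^ 2 = ∑ j, ‖(P * diagonal (fun i => (σ i : ℂ))) i j‖ ^ 2 := by
    have := congrArg (fun M => M i i) e
    simp only [mul_conjTranspose_apply_self] at this
    exact_mod_cast this
  rw [h, ← sum_row_norm_sq hP i]
  refine Finset.sum_le_sum fun j _ => ?_
  rw [mul_diagonal, norm_mul, Complex.norm_real, Real.norm_of_nonneg (h0 j), mul_pow]
  exact mul_le_of_le_one_right (by positivity) (pow_le_one₀ (h0 j) (h1 j))

/-- A diagonal entry of modulus one forces the rest of its row to vanish. -/
theorem row_eq_zero_of_norm_eq_one {k : ℝ} {W : Matrix ι ι ℂ} (hW : W ∈ dualBall ι k) {i j : ι}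
    (hi : ‖W i i‖ = 1) (hij : i ≠ j) : W i j = 0 := by
  have h := sum_row_norm_sq_le_one hW i
  have h2 : ∑ l ∈ {i, j}, ‖W i l‖ ^ 2 ≤ ∑ l, ‖W i l‖ ^ 2 :=
    Finset.sum_le_sum_of_subset_of_nonneg (Finset.subset_univ _) fun _ _ _ => by positivity
  rw [Finset.sum_pair hij, hi] at h2
  have h3 : ‖W i j‖ ^ 2 = 0 := le_antisymm (by linarith) (by positivity)
  simpa using h3

theorem col_eq_zero_of_norm_eq_one {k : ℝ} {W : Matrix ι ι ℂ} (hW : W ∈ dualBall ι k) {i j : ι}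
    (hi : ‖W i i‖ = 1) (hij : i ≠ j) : W j i = 0 := by
  have := row_eq_zero_of_norm_eq_one (conjTranspose_mem_dualBall hW) (i := i) (j := j)
    (by simpa using hi) hij
  simpa using this

theorem norm_diag_le_one {k : ℝ} {W : Matrix ι ι ℂ} (hW : W ∈ dualBall ι k) (i : ι) :
    ‖W i i‖ ≤ 1 := by
  simpa using (hW 1 (one_mem _) 1 (one_mem _)).1 i

theorem sum_norm_diag_le {k : ℝ} {W : Matrix ι ι ℂ} (hW : W ∈ dualBall ι k) :
    ∑ i, ‖W i i‖ ≤ k := by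
  simpa using (hW 1 (one_mem _) 1 (one_mem _)).2

/-! ### Convexity, compactness and separation -/

theorem convex_dualBall (k : ℝ) : Convex ℝ (dualBall ι k) := by
  intro W hW Z hZ a b ha hb hab P hP Q hQ
  obtain ⟨h1, h2⟩ := hW P hP Q hQ
  obtain ⟨h3, h4⟩ := hZ P hP Q hQ
  have h : ∀ i, ‖(Pᴴ * (a • W + b • Z) * Q) i i‖ ≤
      a * ‖(Pᴴ * W * Q) i i‖ + b * ‖(Pᴴ * Z * Q) i i‖ := by
    intro i
    have e : Pᴴ * (a • W + b • Z) * Q = a • (Pᴴ * W * Q) + b • (Pᴴ * Z * Q) := by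
      simp [mul_add, add_mul]
    rw [e, Matrix.add_apply, Matrix.smul_apply, Matrix.smul_apply]
    refine (norm_add_le _ _).trans ?_
    rw [norm_smul, norm_smul, Real.norm_of_nonneg ha, Real.norm_of_nonneg hb]
  refine ⟨fun i => (h i).trans ?_, (Finset.sum_le_sum fun i _ => h i).trans ?_⟩
  · nlinarith [h1 i, h3 i]
  · rw [Finset.sum_add_distrib, ← Finset.mul_sum, ← Finset.mul_sum]
    calc _ ≤ a * k + b * k := by gcongr
      _ = k := by rw [← add_mul, hab, one_mul]

theorem isClosed_dualBall (k : ℝ) : IsClosed (dualBall ι k) := by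
  have hc : ∀ (P Q : Matrix ι ι ℂ) (i : ι),
      Continuous fun W : Matrix ι ι ℂ => ‖(Pᴴ * W * Q) i i‖ := fun P Q i =>
    (((continuous_const.matrix_mul continuous_id).matrix_mul continuous_const).matrix_elem i i).norm
  simp only [dualBall, Set.ofPred_forall, Set.ofPred_and]
  refine isClosed_iInter fun P => isClosed_iInter fun _ => isClosed_iInter fun Q =>
    isClosed_iInter fun _ => (isClosed_iInter fun i => ?_).inter ?_
  · exact isClosed_le (hc P Q i) continuous_const
  · exact isClosed_le (continuous_finsetSum _ fun i _ => hc P Q i) continuous_const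

theorem isCompact_dualBall (k : ℝ) : IsCompact (dualBall ι k) := by
  have hK : IsCompact (Set.univ.pi fun _ : ι => Set.univ.pi fun _ : ι =>
      Metric.closedBall (0 : ℂ) 1) :=
    isCompact_univ_pi fun _ => isCompact_univ_pi fun _ => isCompact_closedBall _ _
  refine IsCompact.of_isClosed_subset hK (isClosed_dualBall k) fun W hW i _ j _ => ?_
  rw [mem_closedBall_zero_iff]
  have h := (Finset.single_le_sum (f := fun j => ‖W i j‖ ^ 2) (fun _ _ => by positivity)
    (Finset.mem_univ j)).trans (sum_row_norm_sq_le_one hW i)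
  exact (sq_le_one_iff₀ (norm_nonneg _)).1 h

theorem continuous_trace_conjTranspose_mul {ι : Type*} [Fintype ι] (X : Matrix ι ι ℂ) :
    Continuous fun W : Matrix ι ι ℂ => (Wᴴ * X).trace :=
  (continuous_id.matrix_conjTranspose.matrix_mul continuous_const).matrix_trace

/-- If every perturbation `S + c B` is paired by some element of the dual ball to at least `N`,
and `S` never exceeds `N`, then some element attaining `N` at `S` annihilates `B`. -/
theorem exists_mem_dualBall_trace_eq_zero {k N : ℝ} {S B : Matrix ι ι ℂ}
    (hle : ∀ W ∈ dualBall ι k, (Wᴴ * S).trace.re ≤ N)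
    (h : ∀ c : ℂ, ∃ W ∈ dualBall ι k, N ≤ (Wᴴ * (S + c • B)).trace.re) :
    ∃ W ∈ dualBall ι k, (Wᴴ * S).trace.re = N ∧ (Wᴴ * B).trace = 0 := by
  let F : Set (Matrix ι ι ℂ) := dualBall ι k ∩ {W | N ≤ (Wᴴ * S).trace.re}
  have hSc : Continuous fun W : Matrix ι ι ℂ => (Wᴴ * S).trace.re :=
    Complex.continuous_re.comp (continuous_trace_conjTranspose_mul S)
  have hBc := continuous_trace_conjTranspose_mul B
  have hFc : IsCompact F :=
    (isCompact_dualBall k).inter_right (isClosed_le continuous_const hSc)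
  have hlin : ∀ X : Matrix ι ι ℂ, IsLinearMap ℝ fun W : Matrix ι ι ℂ => (Wᴴ * X).trace := fun X =>
    ⟨fun W Z => by simp [add_mul], fun a W => by simp [conjTranspose_smul]⟩
  have hFv : Convex ℝ F := by
    refine (convex_dualBall k).inter ?_
    refine convex_halfSpace_ge ⟨fun W Z => ?_, fun a W => ?_⟩ N
    · rw [(hlin S).map_add, Complex.add_re]
    · rw [(hlin S).map_smul, Complex.smul_re]
  by_contra hcon
  have h0 : (0 : ℂ) ∉ (fun W : Matrix ι ι ℂ => (Wᴴ * B).trace) '' F := by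
    rintro ⟨W, hW, hWB⟩
    exact hcon ⟨W, hW.1, le_antisymm (hle W hW.1) hW.2, hWB⟩
  -- If `0` is not a value of `tr(W* B)` on the face `F`, then `Re (f 1 * tr(W* B))` exceeds some `u
  -- > 0` on all of `F`.
  obtain ⟨f, u, hu, hf⟩ := RCLike.geometric_hahn_banach_point_closed (𝕜 := ℂ)
    (hFv.is_linear_image (hlin B)) (hFc.image hBc).isClosed h0
  have hf1 : ∀ z, f z = f 1 * z := fun z => by
    rw [mul_comm, ← smul_eq_mul, ← map_smul, smul_eq_mul, mul_one]
  -- Perturb by `c = -ε f(1)` with `ε = 1/(m+1)`, the direction that lowers the pairing on the face.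
  -- Since `Re tr(W* S) ≤ N`, each chosen `W m` has `Re (f 1 * tr(W* B)) ≤ 0`.
  choose W hWD hWN using fun m : ℕ => h (-((1 / ((m : ℝ) + 1) : ℝ) : ℂ) * f 1)
  have htr : ∀ m, (((W m)ᴴ * (S + (-((1 / ((m : ℝ) + 1) : ℝ) : ℂ) * f 1) • B)).trace).re =
      ((W m)ᴴ * S).trace.re - 1 / ((m : ℝ) + 1) * (f 1 * ((W m)ᴴ * B).trace).re := by
    intro m
    rw [mul_add, trace_add, Matrix.mul_smul, trace_smul, Complex.add_re, smul_eq_mul, mul_assoc,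
      neg_mul, Complex.neg_re, Complex.re_ofReal_mul]
    ring
  have hpos : ∀ m : ℕ, (0 : ℝ) < 1 / ((m : ℝ) + 1) := fun m => Nat.one_div_pos_of_nat
  have hB0 : ∀ m, (f 1 * ((W m)ᴴ * B).trace).re ≤ 0 := by
    intro m
    have h1 := hWN m
    rw [htr] at h1
    by_contra! h2
    nlinarith [hle _ (hWD m), mul_pos (hpos m) h2]
  have : FirstCountableTopology (Matrix ι ι ℂ) :=
    inferInstanceAs (FirstCountableTopology (ι → ι → ℂ))
  -- A limit point `Z` inherits this inequality and, as `ε → 0`, lies in the face: a contradiction.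
  obtain ⟨Z, hZ, φ, hφ, hlim⟩ := (isCompact_dualBall k).tendsto_subseq hWD
  have hg : Continuous fun W : Matrix ι ι ℂ => (f 1 * (Wᴴ * B).trace).re :=
    Complex.continuous_re.comp (continuous_const.mul hBc)
  have hZ0 : (f 1 * (Zᴴ * B).trace).re ≤ 0 :=
    le_of_tendsto' ((hg.tendsto Z).comp hlim) fun m => hB0 _
  have hone := (tendsto_one_div_add_atTop_nhds_zero_nat (𝕜 := ℝ)).comp hφ.tendsto_atTop
  have hZN : N ≤ (Zᴴ * S).trace.re := by
    have hl := ((hSc.tendsto Z).comp hlim).sub (hone.mul ((hg.tendsto Z).comp hlim))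
    rw [zero_mul, sub_zero] at hl
    refine ge_of_tendsto' hl fun m => ?_
    have := hWN (φ m)
    rw [htr] at this
    exact this
  have := hf _ ⟨Z, ⟨hZ, hZN⟩, rfl⟩
  rw [map_zero] at hu
  rw [hf1] at this
  have hu0 : (0 : ℝ) < u := by simpa using hu
  exact absurd (lt_trans hu0 this) (not_lt.2 hZ0)

/-! ### Maximal trace and positivity -/

theorem mem_dualBall_of_mem_unitaryGroup {R : Matrix ι ι ℂ} (hR : R ∈ unitaryGroup ι ℂ) :
    R ∈ dualBall ι (Fintype.card ι) := by
  have := mul_diagonal_mul_mem_dualBall (τ := fun _ => 1) (k := Fintype.card ι) hR (one_mem _)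
    (fun _ => zero_le_one) (fun _ => le_rfl) (by simp)
  simpa using this

theorem eq_one_of_norm_le_one_of_re_eq_one {z : ℂ} (hz : ‖z‖ ≤ 1) (hre : z.re = 1) : z = 1 := by
  have h := Complex.sq_norm_sub_sq_re z
  have h2 : z.im ^ 2 ≤ 0 := by rw [← h, hre]; nlinarith [norm_nonneg z]
  exact Complex.ext hre (by simpa using le_antisymm h2 (sq_nonneg _))

/-- An element of the dual ball whose trace is as large as possible is positive semidefinite. -/
theorem exists_eq_mul_diagonal_mul_of_trace_eq {k : ℝ} {W : Matrix ι ι ℂ} (hW : W ∈ dualBall ι k)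
    (htr : W.trace.re = k) :
    ∃ (P : Matrix ι ι ℂ) (σ : ι → ℝ), W = P * diagonal (fun i => (σ i : ℂ)) * Pᴴ ∧
      ∀ i, 0 ≤ σ i := by
  obtain ⟨P, hP, Q, hQ, σ, hWσ, h0, -, hk⟩ := exists_svd_of_mem_dualBall hW
  refine ⟨P, σ, ?_, h0⟩
  have hR : Pᴴ * Q ∈ unitaryGroup ι ℂ := mul_mem (conjTranspose_mem_unitaryGroup hP) hQ
  have hRD := mem_dualBall_of_mem_unitaryGroup hR
  have h1 : ∑ i, σ i * ((Pᴴ * Q) i i).re = k := by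
    have := trace_conjTranspose_mul_diagonal (1 : Matrix ι ι ℂ) P Q σ
    rw [← hWσ, conjTranspose_one, one_mul, mul_one, htr] at this
    exact this.symm
  -- With `R = Pᴴ * Q`, the chain `k = ∑ σ i * Re (R i i) ≤ ∑ σ i ≤ k` is tight, so `R i i = 1`
  -- wherever `σ i ≠ 0`.
  have h2 : ∀ i, 0 ≤ σ i * (1 - ((Pᴴ * Q) i i).re) := fun i =>
    mul_nonneg (h0 i) (sub_nonneg.2 ((Complex.re_le_norm _).trans (norm_diag_le_one hRD i)))
  have h3 : ∑ i, σ i * (1 - ((Pᴴ * Q) i i).re) = 0 := by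
    refine le_antisymm ?_ (Finset.sum_nonneg fun i _ => h2 i)
    simp only [mul_sub, mul_one, Finset.sum_sub_distrib, h1]
    linarith
  have h4 := (Finset.sum_eq_zero_iff_of_nonneg fun i _ => h2 i).1 h3
  -- Where `σ i ≠ 0`, column `i` of the unitary `Pᴴ * Q` is a standard basis vector, so `Q` may be
  -- replaced by `P`.
  have key : diagonal (fun i => (σ i : ℂ)) * (Pᴴ * Q)ᴴ = diagonal (fun i => (σ i : ℂ)) := by
    ext i j
    rw [diagonal_mul, conjTranspose_apply]
    rcases eq_or_ne (σ i) 0 with hi | hi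
    · simp [hi, diagonal_apply]
    · have h5 : ((Pᴴ * Q) i i).re = 1 := by
        have := (mul_eq_zero.1 (h4 i (Finset.mem_univ i))).resolve_left hi
        linarith
      have h6 := eq_one_of_norm_le_one_of_re_eq_one (norm_diag_le_one hRD i) h5
      rcases eq_or_ne i j with rfl | hij
      · simp [h6]
      · rw [col_eq_zero_of_norm_eq_one hRD (by simp [h6]) hij, diagonal_apply_ne _ hij]
        simp
  calc W = P * (diagonal (fun i => (σ i : ℂ)) * (Pᴴ * Q)ᴴ) * Pᴴ := by
        rw [hWσ, conjTranspose_mul, conjTranspose_conjTranspose]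
        simp only [mul_assoc, mul_conjTranspose_self_of_unitary hP, mul_one]
    _ = _ := by rw [key]

theorem posSemidef_of_trace_eq {k : ℝ} {W : Matrix ι ι ℂ} (hW : W ∈ dualBall ι k)
    (htr : W.trace.re = k) : W.PosSemidef := by
  obtain ⟨P, σ, rfl, h0⟩ := exists_eq_mul_diagonal_mul_of_trace_eq hW htr
  refine PosSemidef.mul_mul_conjTranspose_same (PosSemidef.diagonal fun i => ?_) P
  simpa using h0 i

/-- A zero diagonal entry of a positive semidefinite matrix forces its row to vanish. -/
theorem row_eq_zero_of_trace_eq {k : ℝ} {W : Matrix ι ι ℂ} (hW : W ∈ dualBall ι k)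
    (htr : W.trace.re = k) {i : ι} (hi : W i i = 0) (j : ι) : W i j = 0 := by
  obtain ⟨P, σ, rfl, h0⟩ := exists_eq_mul_diagonal_mul_of_trace_eq hW htr
  have h1 : (P * diagonal (fun i => (σ i : ℂ)) * Pᴴ) i i =
      ((∑ l, σ l * ‖P i l‖ ^ 2 : ℝ) : ℂ) := by
    rw [mul_apply]
    push_cast
    refine Finset.sum_congr rfl fun l _ => ?_
    rw [mul_diagonal, conjTranspose_apply, mul_right_comm, Complex.star_def, Complex.mul_conj,
      Complex.normSq_eq_norm_sq, mul_comm]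
    push_cast
    rfl
  rw [h1, Complex.ofReal_eq_zero,
    Finset.sum_eq_zero_iff_of_nonneg fun l _ => mul_nonneg (h0 l) (sq_nonneg _)] at hi
  rw [mul_apply]
  refine Finset.sum_eq_zero fun l _ => ?_
  rw [mul_diagonal]
  rcases mul_eq_zero.1 (hi l (Finset.mem_univ l)) with h | h
  · simp [h]
  · have : P i l = 0 := by simpa using h
    simp [this]

/-! ### The face at a diagonal matrix -/

section Blocks
variable {α β γ : Type*} [Fintype α] [DecidableEq α] [Fintype β] [DecidableEq β]
  [Fintype γ] [DecidableEq γ]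

theorem fromBlocks_mem_unitaryGroup {P : Matrix β β ℂ} (hP : P ∈ unitaryGroup β ℂ) :
    (fromBlocks 1 0 0 (fromBlocks P 0 0 1) : Matrix (α ⊕ (β ⊕ γ)) (α ⊕ (β ⊕ γ)) ℂ) ∈
      unitaryGroup (α ⊕ (β ⊕ γ)) ℂ := by
  rw [mem_unitaryGroup_iff, star_eq_conjTranspose]
  simp [fromBlocks_conjTranspose, fromBlocks_multiply, mul_conjTranspose_self_of_unitary hP]

/-- Unitaries on the middle block extend by the identity, so tests of `T` are tests of the large
matrix. Conversely, an SVD of `T` padded by singular values `1` and `0` is an SVD of the large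
matrix. -/
theorem fromBlocks_mem_dualBall_iff {T : Matrix β β ℂ} {q : ℝ} :
    (fromBlocks 1 0 0 (fromBlocks T 0 0 0) : Matrix (α ⊕ (β ⊕ γ)) (α ⊕ (β ⊕ γ)) ℂ) ∈
      dualBall (α ⊕ (β ⊕ γ)) (Fintype.card α + q) ↔ T ∈ dualBall β q := by
  constructor
  · intro h P hP Q hQ
    have h1 := h _ (fromBlocks_mem_unitaryGroup hP) _ (fromBlocks_mem_unitaryGroup hQ)
    have e : (fromBlocks 1 0 0 (fromBlocks P 0 0 1) : Matrix (α ⊕ (β ⊕ γ)) (α ⊕ (β ⊕ γ)) ℂ)ᴴ *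
        fromBlocks 1 0 0 (fromBlocks T 0 0 0) * fromBlocks 1 0 0 (fromBlocks Q 0 0 1) =
        fromBlocks 1 0 0 (fromBlocks (Pᴴ * T * Q) 0 0 0) := by
      simp [fromBlocks_conjTranspose, fromBlocks_multiply]
    rw [e, Fintype.sum_sum_type, Fintype.sum_sum_type] at h1
    refine ⟨fun i => ?_, ?_⟩
    · have := h1.1 (Sum.inr (Sum.inl i))
      simpa using this
    · have := h1.2
      simpa using this
  · intro h
    obtain ⟨P, hP, Q, hQ, σ, hT, h0, h1, hq⟩ := exists_svd_of_mem_dualBall h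
    have := mul_diagonal_mul_mem_dualBall (k := Fintype.card α + q)
      (τ := Sum.elim (fun _ : α => 1) (Sum.elim σ (fun _ : γ => 0)))
      (fromBlocks_mem_unitaryGroup (α := α) (γ := γ) hP)
      (fromBlocks_mem_unitaryGroup (α := α) (γ := γ) hQ)
      (by rintro (a | b | c) <;> simp [h0]) (by rintro (a | b | c) <;> simp [h1])
      (by simpa [Fintype.sum_sum_type] using hq)
    convert this using 1
    have hd : (diagonal fun i => ((Sum.elim (fun _ : α => 1) (Sum.elim σ (fun _ : γ => 0)) i : ℝ)
        : ℂ)) = fromBlocks 1 0 0 (fromBlocks (diagonal fun i => (σ i : ℂ)) 0 0 0) := by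
      ext (i | i | i) (j | j | j) <;> simp [diagonal_apply, one_apply]
    rw [hd]
    simp [fromBlocks_conjTranspose, fromBlocks_multiply, hT]

theorem trace_conjTranspose_fromBlocks_mul {β : Type*} [Fintype β] (T : Matrix β β ℂ)
    (B11 : Matrix α α ℂ)
    (B1 : Matrix α (β ⊕ γ) ℂ) (B2 : Matrix (β ⊕ γ) α ℂ) (B22 : Matrix β β ℂ) (B23 : Matrix β γ ℂ)
    (B32 : Matrix γ β ℂ) (B33 : Matrix γ γ ℂ) :
    ((fromBlocks 1 0 0 (fromBlocks T 0 0 0) : Matrix (α ⊕ (β ⊕ γ)) (α ⊕ (β ⊕ γ)) ℂ)ᴴ *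
      fromBlocks B11 B1 B2 (fromBlocks B22 B23 B32 B33)).trace =
      B11.trace + (Tᴴ * B22).trace := by
  simp only [fromBlocks_conjTranspose, fromBlocks_multiply]
  simp [trace, Fintype.sum_sum_type]

/-- The diagonal of an element of the dual ball at which the pairing with the nonnegative diagonal
matrix `diag s` is maximal, when the level set of the threshold `t` is the middle block. -/
theorem diag_of_sum_mul_re_eq {q t : ℝ} {s : α ⊕ (β ⊕ γ) → ℝ} (hs0 : ∀ i, 0 ≤ s i) (ht : 0 ≤ t)
    (hα : ∀ a, t < s (Sum.inl a)) (hβ : ∀ b, s (Sum.inr (Sum.inl b)) = t)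
    (hγ : ∀ c, s (Sum.inr (Sum.inr c)) < t) {W : Matrix (α ⊕ (β ⊕ γ)) (α ⊕ (β ⊕ γ)) ℂ}
    (hW : W ∈ dualBall (α ⊕ (β ⊕ γ)) (Fintype.card α + q))
    (hsum : ∑ i, s i * (W i i).re = ∑ a, s (Sum.inl a) + q * t) :
    (∀ a, W (Sum.inl a) (Sum.inl a) = 1) ∧
      (∀ c, W (Sum.inr (Sum.inr c)) (Sum.inr (Sum.inr c)) = 0) ∧
      (0 < t → W.trace.re = Fintype.card α + q) := by
  have hy1 := norm_diag_le_one hW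
  have hyk := sum_norm_diag_le hW
  have d0 : ∀ a, 0 ≤ (s (Sum.inl a) - t) * (1 - ‖W (Sum.inl a) (Sum.inl a)‖) := fun a =>
    mul_nonneg (sub_nonneg.2 (hα a).le) (sub_nonneg.2 (hy1 _))
  have e0 : ∀ c, 0 ≤ (t - s (Sum.inr (Sum.inr c))) *
      ‖W (Sum.inr (Sum.inr c)) (Sum.inr (Sum.inr c))‖ := fun c =>
    mul_nonneg (sub_nonneg.2 (hγ c).le) (norm_nonneg _)
  have f0 : ∀ i, 0 ≤ s i * (‖W i i‖ - (W i i).re) := fun i =>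
    mul_nonneg (hs0 i) (sub_nonneg.2 (Complex.re_le_norm _))
  have g0 : 0 ≤ t * (Fintype.card α + q - ∑ i, ‖W i i‖) := mul_nonneg ht (sub_nonneg.2 hyk)
  have hD := Finset.sum_nonneg fun a (_ : a ∈ Finset.univ) => d0 a
  have hE := Finset.sum_nonneg fun c (_ : c ∈ Finset.univ) => e0 c
  have hF := Finset.sum_nonneg fun i (_ : i ∈ Finset.univ) => f0 i
  -- The total defect in the rearrangement bound splits into four nonnegative slacks, so all of them
  -- vanish. The last carries the factor `t` and is informative only for `t > 0`.
  have htot : ∑ a, (s (Sum.inl a) - t) * (1 - ‖W (Sum.inl a) (Sum.inl a)‖) +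
      ∑ c, (t - s (Sum.inr (Sum.inr c))) * ‖W (Sum.inr (Sum.inr c)) (Sum.inr (Sum.inr c))‖ +
      ∑ i, s i * (‖W i i‖ - (W i i).re) + t * (Fintype.card α + q - ∑ i, ‖W i i‖) = 0 := by
    simp only [mul_sub (s _), Finset.sum_sub_distrib (fun i => s i * ‖W i i‖), hsum]
    simp only [Fintype.sum_sum_type, hβ, sub_mul, mul_sub, mul_one, Finset.sum_sub_distrib,
      ← Finset.mul_sum, Finset.sum_const, Finset.card_univ, nsmul_eq_mul]
    ring
  have hD0 := (Finset.sum_eq_zero_iff_of_nonneg fun a _ => d0 a).1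
    (by linarith : ∑ a, (s (Sum.inl a) - t) * (1 - ‖W (Sum.inl a) (Sum.inl a)‖) = 0)
  have hE0 := (Finset.sum_eq_zero_iff_of_nonneg fun c _ => e0 c).1 (by linarith)
  have hF0 := (Finset.sum_eq_zero_iff_of_nonneg fun i _ => f0 i).1
    (by linarith : ∑ i, s i * (‖W i i‖ - (W i i).re) = 0)
  have hα1 : ∀ a, W (Sum.inl a) (Sum.inl a) = 1 := by
    intro a
    have h1 := (mul_eq_zero.1 (hD0 a (Finset.mem_univ a))).resolve_left (sub_pos.2 (hα a)).ne'
    have h2 := (mul_eq_zero.1 (hF0 (Sum.inl a) (Finset.mem_univ _))).resolve_left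
      (ht.trans_lt (hα a)).ne'
    exact eq_one_of_norm_le_one_of_re_eq_one (hy1 _) (by linarith)
  have hγ0 : ∀ c, W (Sum.inr (Sum.inr c)) (Sum.inr (Sum.inr c)) = 0 := fun c =>
    norm_eq_zero.1 ((mul_eq_zero.1 (hE0 c (Finset.mem_univ c))).resolve_left
      (sub_pos.2 (hγ c)).ne')
  refine ⟨hα1, hγ0, fun htp => ?_⟩
  have hg : ∑ i, ‖W i i‖ = Fintype.card α + q := by
    have : t * (Fintype.card α + q - ∑ i, ‖W i i‖) = 0 := by linarith
    have := (mul_eq_zero.1 this).resolve_left htp.ne'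
    linarith
  rw [trace, Complex.re_sum, ← hg]
  refine Finset.sum_congr rfl fun i _ => ?_
  rw [diag_apply]
  rcases i with a | b | c
  · simp [hα1]
  · have := (mul_eq_zero.1 (hF0 _ (Finset.mem_univ (Sum.inr (Sum.inl b))))).resolve_left
      (by rw [hβ]; exact htp.ne')
    linarith
  · simp [hγ0]

/-- An element of the dual ball with diagonal `1` on the first block and with vanishing rows and
columns in the last block is block diagonal. -/
theorem eq_fromBlocks_of_diag {k : ℝ} {W : Matrix (α ⊕ (β ⊕ γ)) (α ⊕ (β ⊕ γ)) ℂ}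
    (hW : W ∈ dualBall (α ⊕ (β ⊕ γ)) k) (hα : ∀ a, W (Sum.inl a) (Sum.inl a) = 1)
    (hrow : ∀ c j, W (Sum.inr (Sum.inr c)) j = 0) (hcol : ∀ c j, W j (Sum.inr (Sum.inr c)) = 0) :
    W = fromBlocks 1 0 0 (fromBlocks W.toBlocks₂₂.toBlocks₁₁ 0 0 0) := by
  have h1 : ∀ a j, Sum.inl a ≠ j → W (Sum.inl a) j = 0 := fun a j =>
    row_eq_zero_of_norm_eq_one hW (by simp [hα])
  have h2 : ∀ a j, Sum.inl a ≠ j → W j (Sum.inl a) = 0 := fun a j =>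
    col_eq_zero_of_norm_eq_one hW (by simp [hα])
  ext (i | i | i) (j | j | j)
  · rcases eq_or_ne i j with rfl | hij
    · simp [hα]
    · simp [h1 i (Sum.inl j) (by simpa using hij), one_apply_ne hij]
  all_goals first | rfl | (simp [h1]; done) | (simp [h2]; done) | (simp [hrow]; done) | simp [hcol]

theorem trace_conjTranspose_mul_diagonal_eq_sum (W : Matrix ι ι ℂ) (s : ι → ℝ) :
    (Wᴴ * diagonal (fun i => (s i : ℂ))).trace.re = ∑ i, s i * (W i i).re := by
  simpa using trace_conjTranspose_mul_diagonal W 1 1 s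

theorem re_trace_fromBlocks_mul_diagonal (T : Matrix β β ℂ) {t : ℝ} {s : α ⊕ (β ⊕ γ) → ℝ}
    (hβ : ∀ b, s (Sum.inr (Sum.inl b)) = t) :
    ((fromBlocks 1 0 0 (fromBlocks T 0 0 0) : Matrix (α ⊕ (β ⊕ γ)) (α ⊕ (β ⊕ γ)) ℂ)ᴴ *
      diagonal (fun i => (s i : ℂ))).trace.re = ∑ a, s (Sum.inl a) + T.trace.re * t := by
  rw [trace_conjTranspose_mul_diagonal_eq_sum]
  simp [Fintype.sum_sum_type, hβ, trace, ← Finset.mul_sum, mul_comm]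

/-- Annihilating elements of the exposed face at a diagonal matrix, for a positive threshold. -/
theorem exists_face_iff_of_pos {q t : ℝ} {s : α ⊕ (β ⊕ γ) → ℝ} (hs0 : ∀ i, 0 ≤ s i) (ht : 0 < t)
    (hα : ∀ a, t < s (Sum.inl a)) (hβ : ∀ b, s (Sum.inr (Sum.inl b)) = t)
    (hγ : ∀ c, s (Sum.inr (Sum.inr c)) < t) (B11 : Matrix α α ℂ)
    (B1 : Matrix α (β ⊕ γ) ℂ) (B2 : Matrix (β ⊕ γ) α ℂ) (B22 : Matrix β β ℂ) (B23 : Matrix β γ ℂ)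
    (B32 : Matrix γ β ℂ) (B33 : Matrix γ γ ℂ) :
    (∃ W ∈ dualBall (α ⊕ (β ⊕ γ)) (Fintype.card α + q),
      (Wᴴ * diagonal (fun i => (s i : ℂ))).trace.re = ∑ a, s (Sum.inl a) + q * t ∧
      (Wᴴ * fromBlocks B11 B1 B2 (fromBlocks B22 B23 B32 B33)).trace = 0) ↔
    ∃ T : Matrix β β ℂ, T.PosSemidef ∧ T ∈ dualBall β q ∧ T.trace.re = q ∧
      B11.trace + (Tᴴ * B22).trace = 0 := by
  constructor
  · rintro ⟨W, hW, hN, hB⟩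
    rw [trace_conjTranspose_mul_diagonal_eq_sum] at hN
    obtain ⟨h1, h0, htr⟩ := diag_of_sum_mul_re_eq hs0 ht.le hα hβ hγ hW hN
    have htr := htr ht
    have hP := posSemidef_of_trace_eq hW htr
    have hrow : ∀ c j, W (Sum.inr (Sum.inr c)) j = 0 := fun c j =>
      row_eq_zero_of_trace_eq hW htr (h0 c) j
    have hcol : ∀ c j, W j (Sum.inr (Sum.inr c)) = 0 := fun c j => by
      rw [← hP.1.apply, hrow, star_zero]
    have hWT := eq_fromBlocks_of_diag hW h1 hrow hcol
    refine ⟨W.toBlocks₂₂.toBlocks₁₁, hP.submatrix (fun b => Sum.inr (Sum.inl b)), ?_, ?_, ?_⟩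
    · rw [hWT] at hW
      exact fromBlocks_mem_dualBall_iff.1 hW
    · rw [hWT] at htr
      simpa [trace, Fintype.sum_sum_type] using htr
    · rwa [hWT, trace_conjTranspose_fromBlocks_mul] at hB
  · rintro ⟨T, -, hT, htr, hB⟩
    refine ⟨_, fromBlocks_mem_dualBall_iff.2 hT, ?_, ?_⟩
    · rw [re_trace_fromBlocks_mul_diagonal T hβ, htr]
    · rw [trace_conjTranspose_fromBlocks_mul, hB]

/-- Annihilating elements of the exposed face at a diagonal matrix, for the threshold zero. -/
theorem exists_face_iff_of_zero [IsEmpty γ] {q : ℝ} {s : α ⊕ (β ⊕ γ) → ℝ} (hs0 : ∀ i, 0 ≤ s i)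
    (hα : ∀ a, 0 < s (Sum.inl a)) (hβ : ∀ b, s (Sum.inr (Sum.inl b)) = 0) (B11 : Matrix α α ℂ)
    (B1 : Matrix α (β ⊕ γ) ℂ) (B2 : Matrix (β ⊕ γ) α ℂ) (B22 : Matrix β β ℂ) (B23 : Matrix β γ ℂ)
    (B32 : Matrix γ β ℂ) (B33 : Matrix γ γ ℂ) :
    (∃ W ∈ dualBall (α ⊕ (β ⊕ γ)) (Fintype.card α + q),
      (Wᴴ * diagonal (fun i => (s i : ℂ))).trace.re = ∑ a, s (Sum.inl a) + q * 0 ∧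
      (Wᴴ * fromBlocks B11 B1 B2 (fromBlocks B22 B23 B32 B33)).trace = 0) ↔
    ∃ T ∈ dualBall β q, B11.trace + (Tᴴ * B22).trace = 0 := by
  constructor
  · rintro ⟨W, hW, hN, hB⟩
    rw [trace_conjTranspose_mul_diagonal_eq_sum] at hN
    obtain ⟨h1, -, -⟩ := diag_of_sum_mul_re_eq hs0 le_rfl hα hβ isEmptyElim hW hN
    have hWT := eq_fromBlocks_of_diag hW h1 isEmptyElim isEmptyElim
    refine ⟨W.toBlocks₂₂.toBlocks₁₁, ?_, ?_⟩
    · rw [hWT] at hW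
      exact fromBlocks_mem_dualBall_iff.1 hW
    · rwa [hWT, trace_conjTranspose_fromBlocks_mul] at hB
  · rintro ⟨T, hT, hB⟩
    refine ⟨_, fromBlocks_mem_dualBall_iff.2 hT, ?_, ?_⟩
    · rw [re_trace_fromBlocks_mul_diagonal T hβ, mul_zero, mul_zero]
    · rw [trace_conjTranspose_fromBlocks_mul, hB]

end Blocks

/-! ### Spectral form of membership and transport along the SVD -/

theorem mul_diagonal_mul_mem_dualBall_iff {P Q : Matrix ι ι ℂ} (hP : P ∈ unitaryGroup ι ℂ)
    (hQ : Q ∈ unitaryGroup ι ℂ) {τ : ι → ℝ} {k : ℝ} (h0 : ∀ i, 0 ≤ τ i) :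
    P * diagonal (fun i => (τ i : ℂ)) * Qᴴ ∈ dualBall ι k ↔ (∀ i, τ i ≤ 1) ∧ ∑ i, τ i ≤ k := by
  refine ⟨fun h => ?_, fun h => mul_diagonal_mul_mem_dualBall hP hQ h0 h.1 h.2⟩
  have := h P hP Q hQ
  rw [conjTranspose_mul_mul_of_unitary hP hQ] at this
  simpa [abs_of_nonneg (h0 _)] using this

theorem mem_dualBall_iff_singVal {m : ℕ} (hm : 0 < m) {T : Matrix (Fin m) (Fin m) ℂ} {q : ℝ} :
    T ∈ dualBall (Fin m) q ↔ singVal T 0 ≤ 1 ∧ ∑ j ∈ Finset.range m, singVal T j ≤ q := by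
  obtain ⟨P, hP, Q, hQ, hT⟩ := exists_svd T
  have h := mul_diagonal_mul_mem_dualBall_iff hP hQ (k := q) (τ := fun i : Fin m => singVal T i)
    (fun i => singVal_nonneg T i)
  rw [← hT, Fin.sum_univ_eq_sum_range (fun i => singVal T i)] at h
  rw [h]
  exact and_congr_left fun _ => ⟨fun h1 => h1 ⟨0, hm⟩,
    fun h1 i => (singVal_antitone T (Nat.zero_le _)).trans h1⟩

/-- For a positive semidefinite matrix the spectral decomposition is an SVD. -/
theorem mem_dualBall_iff_eigenvalues {T : Matrix ι ι ℂ} (hT : T.PosSemidef) {q : ℝ} :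
    T ∈ dualBall ι q ↔
      (∀ j, hT.isHermitian.eigenvalues j ≤ 1) ∧ ∑ j, hT.isHermitian.eigenvalues j ≤ q := by
  have h := mul_diagonal_mul_mem_dualBall_iff hT.isHermitian.eigenvectorUnitary.2
    hT.isHermitian.eigenvectorUnitary.2 (k := q) hT.eigenvalues_nonneg
  rw [← h]
  have e := hT.isHermitian.spectral_theorem
  rw [Unitary.conjStarAlgAut_apply] at e
  conv_lhs => rw [e]
  rfl

/-- Pulling an element of the dual ball back along a singular value decomposition. -/
theorem trace_transport {κ : Type*} [Fintype κ] {U V : Matrix ι ι ℂ}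
    (W X : Matrix κ κ ℂ) (e : κ ≃ ι) (hU : U ∈ unitaryGroup ι ℂ) (hV : V ∈ unitaryGroup ι ℂ) :
    ((U * reindex e e W * Vᴴ)ᴴ * (U * reindex e e X * Vᴴ)).trace = (Wᴴ * X).trace := by
  have h1 : (U * reindex e e W * Vᴴ)ᴴ * (U * reindex e e X * Vᴴ) =
      V * ((reindex e e W)ᴴ * reindex e e X) * Vᴴ := by
    simp only [conjTranspose_mul, conjTranspose_conjTranspose, mul_assoc]
    rw [← mul_assoc Uᴴ U, conjTranspose_mul_self_of_unitary hU, one_mul]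
  rw [h1, trace_mul_comm, ← mul_assoc, conjTranspose_mul_self_of_unitary hV, one_mul,
    conjTranspose_reindex, reindex_apply, reindex_apply, submatrix_mul_equiv]
  simp only [trace, diag_apply, submatrix_apply]
  exact e.symm.sum_comp fun i => (Wᴴ * X) i i

/-- The dual characterisation of Birkhoff-James orthogonality in the Ky Fan norm, in the
coordinates of a singular value decomposition. -/
theorem isBJOrthogonal_iff_exists_mem_dualBall {n k : ℕ} (hkn : k ≤ n)
    {U V : Matrix (Fin n) (Fin n) ℂ} (hU : U ∈ unitaryGroup (Fin n) ℂ)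
    (hV : V ∈ unitaryGroup (Fin n) ℂ) (e : κ ≃ Fin n) (S B : Matrix κ κ ℂ) :
    IsBJOrthogonal (kyFanNorm k) (U * reindex e e S * Vᴴ) (U * reindex e e B * Vᴴ) ↔
      ∃ W ∈ dualBall κ k, (Wᴴ * S).trace.re = kyFanNorm k (U * reindex e e S * Vᴴ) ∧
        (Wᴴ * B).trace = 0 := by
  have hadd : ∀ c : ℂ, U * reindex e e S * Vᴴ + c • (U * reindex e e B * Vᴴ) =
      U * reindex e e (S + c • B) * Vᴴ := fun c => by
    simp [mul_add, add_mul, submatrix_add, submatrix_smul]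
  have hto : ∀ W ∈ dualBall κ k, U * reindex e e W * Vᴴ ∈ dualBall (Fin n) k := fun W hW =>
    unitary_mul_mul_mem_dualBall hU hV (submatrix_mem_dualBall hW e.symm)
  have hfrom : ∀ Z ∈ dualBall (Fin n) k, ∃ W ∈ dualBall κ k, U * reindex e e W * Vᴴ = Z := by
    intro Z hZ
    have h1 := unitary_mul_mul_mem_dualBall (conjTranspose_mem_unitaryGroup hU)
      (conjTranspose_mem_unitaryGroup hV) hZ
    refine ⟨_, submatrix_mem_dualBall h1 e, ?_⟩
    have h2 := conjTranspose_mul_mul_of_unitary (conjTranspose_mem_unitaryGroup hU)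
      (conjTranspose_mem_unitaryGroup hV) Z
    simpa using h2
  constructor
  · intro h
    refine exists_mem_dualBall_trace_eq_zero (fun W hW => ?_) (fun c => ?_)
    · rw [← trace_transport W S e hU hV]
      exact re_trace_le_kyFanNorm hkn (hto W hW) _
    · obtain ⟨Z, hZ, hZc⟩ := exists_re_trace_eq_kyFanNorm hkn (U * reindex e e (S + c • B) * Vᴴ)
      obtain ⟨W, hW, rfl⟩ := hfrom Z hZ
      refine ⟨W, hW, ?_⟩
      rw [trace_transport _ _ e hU hV] at hZc
      rw [hZc, ← hadd]
      exact h c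
  · rintro ⟨W, hW, hS, hB⟩ c
    rw [hadd, ge_iff_le, ← hS]
    refine le_trans (le_of_eq ?_) (re_trace_le_kyFanNorm hkn (hto W hW) _)
    rw [trace_transport _ _ e hU hV, mul_add, Matrix.mul_smul, trace_add, trace_smul, hB, smul_zero,
      add_zero]

/-! ### Index bookkeeping for the blocks -/

/-- If the value `t` of an antitone sequence is taken exactly `r + q` times and on all of
`[k - q, k + r)`, then it is taken nowhere else. -/
theorem eq_middle_of_card {n k q r : ℕ} (hqk : q ≤ k) (hkr : k + r ≤ n) {s : ℕ → ℝ} {t : ℝ}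
    (hcard : Nat.card {i : Fin n // s i = t} = r + q)
    (heq : ∀ i : ℕ, k - q ≤ i → i < k + r → s i = t) {i : ℕ} (hi : i < n) (hit : s i = t) :
    k - q ≤ i ∧ i < k + r := by
  classical
  let f : Fin (r + q) ↪ Fin n := ⟨fun b => ⟨k - q + b, by omega⟩, fun a b h => by
    simp only [Fin.mk.injEq] at h
    omega⟩
  have hsub : Finset.univ.map f ⊆ Finset.univ.filter fun i : Fin n => s i = t := by
    intro x hx
    obtain ⟨b, -, rfl⟩ := Finset.mem_map.1 hx
    simp only [Finset.mem_filter, Finset.mem_univ, true_and]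
    exact heq _ (Nat.le_add_right _ _) (by change k - q + (b : ℕ) < k + r; omega)
  have hle : (Finset.univ.filter fun i : Fin n => s i = t).card ≤ (Finset.univ.map f).card := by
    rw [Finset.card_map, Finset.card_univ, Fintype.card_fin, ← hcard, Nat.card_eq_fintype_card,
      Fintype.card_subtype]
  have h := Finset.eq_of_subset_of_card_le hsub hle
  have hmem : (⟨i, hi⟩ : Fin n) ∈ Finset.univ.map f := by
    rw [h]
    simpa using hit
  obtain ⟨b, -, hb⟩ := Finset.mem_map.1 hmem
  have : k - q + (b : ℕ) = i := congrArg Fin.val hb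
  omega

theorem blockEquiv_inl {n k q r : ℕ} (hqk : q ≤ k) (hkr : k + r ≤ n) (a : Fin (k - q)) :
    (blockEquiv n k q r hqk hkr (Sum.inl a) : ℕ) = a := by
  simp [blockEquiv]

theorem blockEquiv_inr_inl {n k q r : ℕ} (hqk : q ≤ k) (hkr : k + r ≤ n) (b : Fin (r + q)) :
    (blockEquiv n k q r hqk hkr (Sum.inr (Sum.inl b)) : ℕ) = k - q + b := by
  simp [blockEquiv]

theorem blockEquiv_inr_inr {n k q r : ℕ} (hqk : q ≤ k) (hkr : k + r ≤ n) (c : Fin (n - k - r)) :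
    (blockEquiv n k q r hqk hkr (Sum.inr (Sum.inr c)) : ℕ) = k - q + (r + q + c) := by
  simp [blockEquiv]

theorem sum_range_eq_of_eqOn {k q r : ℕ} (hqk : q ≤ k) {s : ℕ → ℝ} {t : ℝ}
    (heq : ∀ i : ℕ, k - q ≤ i → i < k + r → s i = t) :
    ∑ i ∈ Finset.range k, s i = ∑ a : Fin (k - q), s a + q * t := by
  obtain ⟨p, rfl⟩ := Nat.exists_eq_add_of_le' hqk
  rw [Finset.sum_range_add, Nat.add_sub_cancel, Fin.sum_univ_eq_sum_range s]
  congr 1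
  rw [Finset.sum_congr rfl fun i hi => heq (p + i) (by omega)
    (by have := Finset.mem_range.1 hi; omega)]
  simp

end

end KyFanBJ

/-! ### The characterisation of orthogonality -/

theorem theorem2 (n k q r : ℕ) (hk1 : 1 ≤ k) (hq1 : 1 ≤ q) (hqk : q ≤ k) (hkr : k + r ≤ n)
    (A B U S V : Matrix (Fin n) (Fin n) ℂ) (hSVD : KyFanBJ.IsSVD A U S V)
    (hmult : KyFanBJ.singMult A (KyFanBJ.singVal A (k - 1)) = r + q)
    (heq : ∀ i : ℕ, k - q ≤ i → i < k + r →
      KyFanBJ.singVal A i = KyFanBJ.singVal A (k - 1))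
    (B11 : Matrix (Fin (k - q)) (Fin (k - q)) ℂ)
    (B12 : Matrix (Fin (k - q)) (Fin (r + q)) ℂ)
    (B13 : Matrix (Fin (k - q)) (Fin (n - k - r)) ℂ)
    (B21 : Matrix (Fin (r + q)) (Fin (k - q)) ℂ)
    (B22 : Matrix (Fin (r + q)) (Fin (r + q)) ℂ)
    (B23 : Matrix (Fin (r + q)) (Fin (n - k - r)) ℂ)
    (B31 : Matrix (Fin (n - k - r)) (Fin (k - q)) ℂ)
    (B32 : Matrix (Fin (n - k - r)) (Fin (r + q)) ℂ)
    (B33 : Matrix (Fin (n - k - r)) (Fin (n - k - r)) ℂ)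
    (hB : B = U * KyFanBJ.blockMatrix n k q r hqk hkr B11 B12 B13 B21 B22 B23 B31 B32 B33 *
      V.conjTranspose) :
    (0 < KyFanBJ.singVal A (k - 1) →
      (KyFanBJ.IsBJOrthogonal (KyFanBJ.kyFanNorm k) A B ↔
        ∃ (T : Matrix (Fin (r + q)) (Fin (r + q)) ℂ) (hT : T.PosSemidef),
          (∀ j, hT.isHermitian.eigenvalues j ≤ 1) ∧
          (∑ j, hT.isHermitian.eigenvalues j = (q : ℝ)) ∧
          B11.trace + (T.conjTranspose * B22).trace = 0)) ∧
    (KyFanBJ.singVal A (k - 1) = 0 →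
      (KyFanBJ.IsBJOrthogonal (KyFanBJ.kyFanNorm k) A B ↔
        ∃ T : Matrix (Fin (r + q) ⊕ Fin (n - k - r)) (Fin (r + q)) ℂ,
          KyFanBJ.singVal T 0 ≤ 1 ∧
          (∑ j ∈ Finset.range (r + q), KyFanBJ.singVal T j ≤ (q : ℝ)) ∧
          B11.trace + (T.conjTranspose * Matrix.fromRows B22 B32).trace = 0)) := by
  obtain ⟨hU, hV, hS, hA⟩ := hSVD
  let e := KyFanBJ.blockEquiv n k q r hqk hkr
  let s : Fin (k - q) ⊕ (Fin (r + q) ⊕ Fin (n - k - r)) → ℝ := fun i => KyFanBJ.singVal A (e i)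
  set t := KyFanBJ.singVal A (k - 1) with ht
  have hanti := KyFanBJ.singVal_antitone A
  have hs0 : ∀ i, 0 ≤ s i := fun i => KyFanBJ.singVal_nonneg A _
  have hmid := fun (i : ℕ) (hi : i < n) (hit : KyFanBJ.singVal A i = t) =>
    KyFanBJ.eq_middle_of_card hqk hkr hmult heq hi hit
  -- Monotonicity gives `≤`; equality would put the index in the middle block, because the
  -- multiplicity of `t` is exactly `r + q`.
  have hα : ∀ a, t < s (Sum.inl a) := by
    intro a
    have ha : (e (Sum.inl a) : ℕ) = a := KyFanBJ.blockEquiv_inl hqk hkr a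
    have h1 := a.2
    refine lt_of_le_of_ne (hanti (by omega)) fun h => ?_
    have := hmid _ (e (Sum.inl a)).2 h.symm
    omega
  have hβ : ∀ b, s (Sum.inr (Sum.inl b)) = t := by
    intro b
    have hb : (e (Sum.inr (Sum.inl b)) : ℕ) = k - q + b := KyFanBJ.blockEquiv_inr_inl hqk hkr b
    have h1 := b.2
    exact heq _ (by omega) (by omega)
  have hγ : ∀ c, s (Sum.inr (Sum.inr c)) < t := by
    intro c
    have hc : (e (Sum.inr (Sum.inr c)) : ℕ) = k - q + (r + q + c) :=
      KyFanBJ.blockEquiv_inr_inr hqk hkr c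
    refine lt_of_le_of_ne (hanti (by omega)) fun h => ?_
    have := hmid _ (e (Sum.inr (Sum.inr c))).2 h
    omega
  have hSe : S = Matrix.reindex e e (Matrix.diagonal fun i => (s i : ℂ)) := by
    rw [hS, Matrix.reindex_apply, Matrix.submatrix_diagonal_equiv]
    congr 1
    ext i
    simp [s]
  have hN : KyFanBJ.kyFanNorm k A = ∑ a, s (Sum.inl a) + q * t := by
    rw [KyFanBJ.kyFanNorm, KyFanBJ.sum_range_eq_of_eqOn hqk heq]
    congr 1
  have hAe := hA
  rw [hSe] at hAe
  have hkey := KyFanBJ.isBJOrthogonal_iff_exists_mem_dualBall (k := k) (by omega) hU hV e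
    (Matrix.diagonal fun i => (s i : ℂ))
    (Matrix.fromBlocks B11 (Matrix.fromCols B12 B13) (Matrix.fromRows B21 B31)
      (Matrix.fromBlocks B22 B23 B32 B33))
  have hcard : (k : ℝ) = (Fintype.card (Fin (k - q)) : ℝ) + q := by
    rw [Fintype.card_fin, Nat.cast_sub hqk]
    ring
  rw [← hAe, hN, hcard] at hkey
  rw [KyFanBJ.blockMatrix] at hB
  rw [hB]
  refine ⟨fun htp => ?_, fun ht0 => ?_⟩
  · rw [hkey, KyFanBJ.exists_face_iff_of_pos hs0 htp hα hβ hγ]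
    have hsum : ∀ {T : Matrix (Fin (r + q)) (Fin (r + q)) ℂ} (hT : T.PosSemidef),
        T.trace.re = ∑ j, hT.isHermitian.eigenvalues j := fun hT => by
      rw [hT.isHermitian.trace_eq_sum_eigenvalues]
      simp
    constructor
    · rintro ⟨T, hT, hTD, htr, hTB⟩
      exact ⟨T, hT, ((KyFanBJ.mem_dualBall_iff_eigenvalues hT).1 hTD).1, (hsum hT).symm.trans htr,
        hTB⟩
    · rintro ⟨T, hT, h1, h2, hTB⟩
      exact ⟨T, hT, (KyFanBJ.mem_dualBall_iff_eigenvalues hT).2 ⟨h1, h2.le⟩, (hsum hT).trans h2,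
        hTB⟩
  · rw [hkey, ht0]
    -- No singular value lies below `s_k(A) = 0`, so the third block is empty and the rectangular
    -- `T` of part (b) is really square.
    have : IsEmpty (Fin (n - k - r)) := ⟨fun c => by
      have := hγ c
      rw [ht0] at this
      exact absurd this (not_lt.2 (hs0 _))⟩
    rw [KyFanBJ.exists_face_iff_of_zero hs0 (fun a => ht0 ▸ hα a) (fun b => (hβ b).trans ht0)]
    have hrows : ∀ T : Matrix (Fin (r + q) ⊕ Fin (n - k - r)) (Fin (r + q)) ℂ,
        T = Matrix.fromRows T.toRows₁ 0 := fun T => by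
      ext (i | i) j
      · rfl
      · exact isEmptyElim i
    have hsv : ∀ (T : Matrix (Fin (r + q)) (Fin (r + q)) ℂ) (i : ℕ),
        KyFanBJ.singVal (Matrix.fromRows T (0 : Matrix (Fin (n - k - r)) (Fin (r + q)) ℂ)) i =
          KyFanBJ.singVal T i := fun T i => by
      refine KyFanBJ.singVal_congr ?_ i
      simp [Matrix.conjTranspose_fromRows_eq_fromCols_conjTranspose, Matrix.fromCols_mul_fromRows]
    have htr : ∀ T : Matrix (Fin (r + q)) (Fin (r + q)) ℂ,
        ((Matrix.fromRows T (0 : Matrix (Fin (n - k - r)) (Fin (r + q)) ℂ)).conjTranspose *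
          Matrix.fromRows B22 B32) = T.conjTranspose * B22 := fun T => by
      simp [Matrix.conjTranspose_fromRows_eq_fromCols_conjTranspose, Matrix.fromCols_mul_fromRows]
    constructor
    · rintro ⟨T, hT, hTB⟩
      obtain ⟨h1, h2⟩ := (KyFanBJ.mem_dualBall_iff_singVal (by omega)).1 hT
      refine ⟨Matrix.fromRows T 0, ?_⟩
      simp only [hsv, htr]
      exact ⟨h1, h2, hTB⟩
    · rintro ⟨T, hT⟩
      rw [hrows T] at hT
      simp only [hsv, htr] at hT
      exact ⟨_, (KyFanBJ.mem_dualBall_iff_singVal (by omega)).2 ⟨hT.1, hT.2.1⟩, hT.2.2⟩
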